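/- Let $K$ be a field of characteristic zero, let $X=(x_1,\dots,x_n)$ and $Y=(y_1,\dots,y_m)$ be disjoint tuples of variables, and let $p\in K[X,Y]$. A \emph{separated multiple} of $p$ is a nonzero multiple of $p$ in $K[X,Y]$ of the form $f-g$ with $f\in K[X]$ and $g\in K[Y]$. For an ideal $I\subseteq K[X,Y]$, let $A(I)$ be the $K$-algebra of all pairs $(f,g)\in K[X]\times K[Y]$ with $f-g\in I$, with componentwise operations. Suppose that $p$ has a separated multiple. Then: 1. $p$ has a separated multiple that divides every separated multiple of $p$ in $K[X,Y]$; call such a polynomial a \emph{minimal separated multiple} of $p$. 2. It is unique up to a multiplicative constant: if $q$ is a minimal separated multiple of $p$, then the minimal separated multiples of $p$ are exactly the polynomials $cq$ with $c\in K\setminus\{0\}$. 3. If moreover $p\notin K[X]\cup K[Y]$, then the $K$-algebra $A(\langle p\rangle)$ is generated by a single element, and for all $f\in K[X]$ and $g\in K[Y]$, the pair $(f,g)$ generates $A(\langle p\rangle)$ as a $K$-algebra if and only if $f-g$ is a minimal separated multiple of $p$. -/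

import Mathlib

namespace SeparatedPolynomials

variable {K : Type*} [Field K] {n m : ℕ}

/-- The inclusion of `K[x₁,…,xₙ]` into `K[x₁,…,xₙ,y₁,…,yₘ]`. -/
noncomputable def inX (K : Type*) [Field K] (n m : ℕ) :
    MvPolynomial (Fin n) K →ₐ[K] MvPolynomial (Fin n ⊕ Fin m) K :=
  MvPolynomial.rename Sum.inl

/-- The inclusion of `K[y₁,…,yₘ]` into `K[x₁,…,xₙ,y₁,…,yₘ]`. -/
noncomputable def inY (K : Type*) [Field K] (n m : ℕ) :
    MvPolynomial (Fin m) K →ₐ[K] MvPolynomial (Fin n ⊕ Fin m) K :=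
  MvPolynomial.rename Sum.inr

/-- A polynomial is separated if it has the form `f - g` with `f ∈ K[X]` and `g ∈ K[Y]`. -/
def IsSeparated (q : MvPolynomial (Fin n ⊕ Fin m) K) : Prop :=
  ∃ (f : MvPolynomial (Fin n) K) (g : MvPolynomial (Fin m) K), q = inX K n m f - inY K n m g

/-- `q` is a separated multiple of `p`: a nonzero multiple of `p` that is separated. -/
def IsSeparatedMultiple (p q : MvPolynomial (Fin n ⊕ Fin m) K) : Prop :=
  q ≠ 0 ∧ IsSeparated q ∧ p ∣ q

/-- `q` is a separated multiple of `p` that divides every separated multiple of `p`. -/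
def IsMinimalSeparatedMultiple (p q : MvPolynomial (Fin n ⊕ Fin m) K) : Prop :=
  IsSeparatedMultiple p q ∧ ∀ r, IsSeparatedMultiple p r → q ∣ r

/-- The algebra `A(I)` of separated elements of `I`: all `(f, g) ∈ K[X] × K[Y]` with
`f - g ∈ I`, with componentwise operations. -/
noncomputable def separatedAlgebra (I : Ideal (MvPolynomial (Fin n ⊕ Fin m) K)) :
    Subalgebra K (MvPolynomial (Fin n) K × MvPolynomial (Fin m) K) where
  carrier := {a | inX K n m a.1 - inY K n m a.2 ∈ I}
  mul_mem' := by
    intro a b ha hb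
    simp only [Set.mem_setOf_eq, Prod.fst_mul, Prod.snd_mul, map_mul] at *
    have h := I.add_mem (I.mul_mem_right (inX K n m b.1) ha) (I.mul_mem_left (inY K n m a.2) hb)
    convert h using 1
    ring
  add_mem' := by
    intro a b ha hb
    simp only [Set.mem_setOf_eq, Prod.fst_add, Prod.snd_add, map_add] at *
    have h := I.add_mem ha hb
    convert h using 1
    ring
  algebraMap_mem' := by
    intro c
    have h1 : inX K n m ((algebraMap K (MvPolynomial (Fin n) K × MvPolynomial (Fin m) K) c).1) =
        algebraMap K _ c := (inX K n m).commutes c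
    have h2 : inY K n m ((algebraMap K (MvPolynomial (Fin n) K × MvPolynomial (Fin m) K) c).2) =
        algebraMap K _ c := (inY K n m).commutes c
    simp only [Set.mem_setOf_eq, h1, h2, sub_self, I.zero_mem]

/-- The pair `(f, g)` generates `A(⟨p⟩)` as a `K`-algebra. -/
def IsGenerator (p : MvPolynomial (Fin n ⊕ Fin m) K)
    (f : MvPolynomial (Fin n) K) (g : MvPolynomial (Fin m) K) : Prop :=
  Algebra.adjoin K {(f, g)} = separatedAlgebra (Ideal.span {p})

end SeparatedPolynomials

/-! If `p` lies in `K[X]` or `K[Y]`, it is separated and is its own minimal separated multiple.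
Otherwise let `A = A(⟨p⟩)`. Both projections of `A` are injective, and `A` is integrally closed: an
integral fraction becomes a polynomial `s` in `K[X]` and `t` in `K[Y]`, and coprimality of `K[X]`
and `K[Y]` gives `p ∣ s - t` (`isIntegrallyClosed_separatedAlgebra`).

Restricting `g` to a suitable line through the origin embeds `A` in `K[T]`. An integrally closed
subalgebra of `K[T]` with a nonconstant element is `K[h]`, a Lüroth-type argument
(`exists_eq_adjoin_singleton`), so `A` has a generator `(f, g)`. Its elements are the pairs `(P(f),
P(g))`, and `f - g ∣ P(f) - P(g)`; hence `f - g` is minimal. -/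

/-! ### Integrally closed subalgebras of `K[T]` -/

section Polynomial

open Polynomial

theorem Polynomial.Bivariate.coeff_coeff_swap {R : Type*} [CommRing R] (P : R[X][X]) (i j : ℕ) :
    ((Bivariate.swap P).coeff j).coeff i = (P.coeff i).coeff j := by
  induction P using Polynomial.induction_on' with
  | add p q hp hq => simp [hp, hq]
  | monomial k f =>
    induction f using Polynomial.induction_on' with
    | add p q hp hq => simp only [map_add, coeff_add, hp, hq]
    | monomial l r =>
      rw [Bivariate.swap_monomial_monomial]
      simp only [coeff_monomial]
      split_ifs <;> simp_all [coeff_monomial]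

namespace Subalgebra

variable {K : Type*} [Field K] (B : Subalgebra K K[X])

theorem isIntegral_X_of_mem {h : K[X]} (hB : h ∈ B) (h1 : h.Monic) (h0 : h.natDegree ≠ 0) :
    IsIntegral B (X : K[X]) := by
  refine ⟨h.map (algebraMap K B) - C ⟨h, hB⟩, ?_, ?_⟩
  · refine (h1.map _).sub_of_left ?_
    rw [degree_map]
    exact degree_C_le.trans_lt (natDegree_pos_iff_degree_pos.1 (Nat.pos_of_ne_zero h0))
  · have : eval₂ (algebraMap B K[X]) X (h.map (algebraMap K B)) = h := by
      rw [eval₂_map, ← IsScalarTower.algebraMap_eq K B K[X]]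
      exact aeval_X_left_apply h
    rw [eval₂_sub, this, eval₂_C]
    exact sub_self h

/-- Some coefficient of the minimal polynomial of `X` over an integrally closed subalgebra of
`K[X]` has the same degree as that minimal polynomial. -/
theorem exists_monic_mem_natDegree_eq_natDegree_minpoly [IsIntegrallyClosed B]
    (hX : IsIntegral B (X : K[X])) :
    ∃ h ∈ B, h.Monic ∧ h.natDegree ≠ 0 ∧ h.natDegree = (minpoly B (X : K[X])).natDegree := by
  set M := minpoly B (X : K[X])
  set N : K[X][X] := M.map (algebraMap B K[X]) with hN
  have hNm : N.Monic := (minpoly.monic hX).map _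
  have hNX : N.eval X = 0 := by
    rw [hN, eval_map_algebraMap]
    exact minpoly.aeval B X
  set S := Bivariate.swap N with hS
  have hS0 : S ≠ 0 := by
    rw [hS, Ne, EmbeddingLike.map_eq_zero_iff]
    exact hNm.ne_zero
  set e := S.natDegree
  -- Otherwise `N` has coefficients in `K`, and `X` would be algebraic over `K`.
  have he0 : e ≠ 0 := by
    intro h0
    obtain ⟨q, hq⟩ := natDegree_eq_zero.1 h0
    have h1 : N = q.map C := by
      rw [← Bivariate.swap_C, hq, hS, Bivariate.swap_swap_apply]
    have h2 : q = 0 := by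
      rw [h1, eval_map] at hNX
      exact (aeval_X_left_apply q).symm.trans hNX
    exact hNm.ne_zero (by rw [h1, h2, Polynomial.map_zero])
  -- Pick a coefficient of `N` of maximal degree `e` in the inner variable; normalized, it is `h`.
  obtain ⟨i, hi⟩ : ∃ i, (S.coeff e).coeff i ≠ 0 := by
    by_contra! hc
    exact hS0 (leadingCoeff_eq_zero.1 (Polynomial.ext hc))
  rw [hS, Bivariate.coeff_coeff_swap] at hi
  have hNi : N.coeff i ∈ B := by
    rw [hN, coeff_map]
    exact (M.coeff i).2
  have hdeg : (N.coeff i).natDegree = e := by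
    refine le_antisymm (natDegree_le_iff_coeff_eq_zero.2 fun j hj => ?_) (le_natDegree_of_ne_zero hi)
    rw [← Bivariate.coeff_coeff_swap, ← hS, coeff_eq_zero_of_natDegree_lt hj, coeff_zero]
  have hne : N.coeff i ≠ 0 := by
    rintro h
    rw [h] at hi
    exact hi rfl
  have hl : (N.coeff i).leadingCoeff ≠ 0 := leadingCoeff_ne_zero.2 hne
  set h := N.coeff i * C (N.coeff i).leadingCoeff⁻¹ with hh
  have hmon : h.Monic := monic_mul_leadingCoeff_inv hne
  have hhe : h.natDegree = e := by
    rw [hh, natDegree_mul_C (inv_ne_zero hl), hdeg]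
  have hhB : h ∈ B := B.mul_mem hNi (B.algebraMap_mem _)
  refine ⟨h, hhB, hmon, hhe ▸ he0, ?_⟩
  -- `X` is a root of `h(Z) - h` over `B`.
  have hdvd : N ∣ h.map C - C h := by
    have h1 : M ∣ h.map (algebraMap K B) - C ⟨h, hhB⟩ := by
      refine minpoly.isIntegrallyClosed_dvd hX ?_
      rw [map_sub, aeval_map_algebraMap, aeval_C, aeval_X_left_apply]
      exact sub_self h
    have h2 := Polynomial.map_dvd (algebraMap B K[X]) h1
    rw [Polynomial.map_sub, Polynomial.map_map, ← IsScalarTower.algebraMap_eq K B K[X],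
      Polynomial.map_C] at h2
    exact h2
  obtain ⟨Q, hQ⟩ := hdvd
  have hsw : C h - h.map C = S * Bivariate.swap Q := by
    rw [hS, ← map_mul, ← hQ, map_sub, Bivariate.swap_C, Bivariate.swap_map_C]
  have hdD : (h.map C - C h).natDegree = e := by
    rw [natDegree_sub_C, natDegree_map_eq_of_injective (C_injective), hhe]
  have hdS : (C h - h.map C).natDegree = e := by
    rw [← natDegree_neg, neg_sub]
    exact hdD
  have hQ0 : Bivariate.swap Q ≠ 0 := by
    rintro h0
    rw [hsw, h0, mul_zero, natDegree_zero] at hdS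
    exact he0 hdS.symm
  -- `h(Z) - h(X)` and `N` both have degree `e` in `X`, so `Q` involves only `Z`. It divides the
  -- coefficient `-1` of `X ^ e`, so it is constant; now compare degrees in `Z`.
  have hQd : (Bivariate.swap Q).natDegree = 0 := by
    rw [hsw, natDegree_mul hS0 hQ0] at hdS
    omega
  obtain ⟨q, hq⟩ := natDegree_eq_zero.1 hQd
  have hqu : IsUnit q := by
    have h3 : (C h - h.map C).coeff e = S.coeff e * q := by
      rw [hsw, ← hq, coeff_mul_C]
    rw [coeff_sub, coeff_C_of_ne_zero he0, zero_sub, coeff_map, ← hhe, hmon.coeff_natDegree,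
      map_one] at h3
    exact isUnit_of_dvd_unit (Dvd.intro_left _ h3.symm) isUnit_one.neg
  obtain ⟨c, hc, hcq⟩ := Polynomial.isUnit_iff.1 hqu
  have hQc : Q = C (C c) := by
    rw [← Bivariate.swap_swap_apply Q, ← hq, ← hcq, Bivariate.swap_C_C]
  rw [hQ, hQc, natDegree_mul_C (by simpa using hc.ne_zero), hN,
    natDegree_map_eq_of_injective (FaithfulSMul.algebraMap_injective B K[X])] at hdD
  rw [hhe, hdD]

/-- An integrally closed subalgebra of `K[X]` that contains a nonconstant polynomial is generated
by one element. -/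
theorem exists_eq_adjoin_singleton [IsIntegrallyClosed B] {f : K[X]} (hf : f ∈ B)
    (hf0 : f.natDegree ≠ 0) : ∃ h, B = Algebra.adjoin K {h} := by
  have hfne : f ≠ 0 := by
    rintro rfl
    exact hf0 natDegree_zero
  have hX : IsIntegral B (X : K[X]) := by
    refine isIntegral_X_of_mem B (h := f * C f.leadingCoeff⁻¹)
      (B.mul_mem hf (B.algebraMap_mem _)) (monic_mul_leadingCoeff_inv hfne) ?_
    rwa [natDegree_mul_C (inv_ne_zero (leadingCoeff_ne_zero.2 hfne))]
  obtain ⟨h, hB, hmon, h0, hdeg⟩ := B.exists_monic_mem_natDegree_eq_natDegree_minpoly hX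
  have hle : Algebra.adjoin K {h} ≤ B := Algebra.adjoin_le (by simpa using hB)
  refine ⟨h, le_antisymm (fun F hF => ?_) hle⟩
  set A := Algebra.adjoin K {h}
  let P : A[X] := h.map (algebraMap K A) - C ⟨h, Algebra.self_mem_adjoin_singleton K h⟩
  have hPlt : (C (⟨h, Algebra.self_mem_adjoin_singleton K h⟩ : A)).degree <
      (h.map (algebraMap K A)).degree := by
    rw [degree_map]
    exact degree_C_le.trans_lt (natDegree_pos_iff_degree_pos.1 (Nat.pos_of_ne_zero h0))
  have hP : P.Monic := (hmon.map _).sub_of_left hPlt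
  have hPd : P.degree = h.natDegree := by
    rw [degree_sub_eq_left_of_degree_lt hPlt, degree_map, degree_eq_natDegree hmon.ne_zero]
  have hPX : aeval (X : K[X]) P = 0 := by
    refine (map_sub (aeval (R := A) (X : K[X])) _ _).trans ?_
    rw [aeval_map_algebraMap, aeval_C, aeval_X_left_apply]
    exact sub_self h
  -- `R` has value `F` at `X` and degree below `deg h`, the degree of the minimal polynomial over
  -- `B`. So `R - F` vanishes identically, and `F` is the constant coefficient of `R`, which lies in
  -- `K[h]`.
  set R := F.map (algebraMap K A) %ₘ P
  have hRX : aeval (X : K[X]) R = F := by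
    have := congrArg (aeval (X : K[X])) (modByMonic_add_div (F.map (algebraMap K A)) P)
    rwa [map_add, map_mul, hPX, zero_mul, add_zero, aeval_map_algebraMap,
      aeval_X_left_apply] at this
  let ι : A →+* B := (Subalgebra.inclusion hle).toRingHom
  have hT : R.map ι - C ⟨F, hF⟩ = 0 := by
    by_contra hne
    have hroot : aeval (X : K[X]) (R.map ι - C ⟨F, hF⟩) = 0 := by
      refine (map_sub (aeval (R := B) (X : K[X])) _ _).trans ?_
      rw [aeval_C, aeval_def, eval₂_map]
      exact sub_eq_zero.2 hRX
    have h1 := minpoly.IsIntegrallyClosed.degree_le_of_ne_zero hne hroot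
    rw [degree_eq_natDegree (minpoly.ne_zero hX), ← hdeg] at h1
    refine absurd h1 (not_le.2 (lt_of_le_of_lt (degree_sub_le _ _) (max_lt ?_ ?_)))
    · exact lt_of_le_of_lt degree_map_le (hPd ▸ degree_modByMonic_lt _ hP)
    · exact degree_C_le.trans_lt (by exact_mod_cast Nat.pos_of_ne_zero h0)
  have h2 := congrArg (fun q : B[X] => ((q.coeff 0 : B) : K[X])) hT
  simp only [coeff_sub, coeff_map, coeff_C_zero, coeff_zero] at h2
  have h3 : ((R.coeff 0 : A) : K[X]) = F := sub_eq_zero.1 h2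
  exact h3 ▸ (R.coeff 0).2

end Subalgebra

end Polynomial

/-! ### Integral fractions and divisors -/

section IntegralClosure

/-- `φ` extends to the fraction fields and carries the integral equation over to `S`. -/
theorem dvd_map_of_isIntegral_div {R S : Type*} [CommRing R] [IsDomain R] [CommRing S] [IsDomain S]
    [IsIntegrallyClosed S] (φ : R →+* S) (hφ : Function.Injective φ) {a b : R} (hb : b ≠ 0)
    (hx : IsIntegral R (algebraMap R (FractionRing R) a / algebraMap R (FractionRing R) b)) :
    φ b ∣ φ a := by
  let ψ : FractionRing R →+* FractionRing S := IsFractionRing.map hφ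
  have hψ (r : R) : ψ (algebraMap R _ r) = algebraMap S _ (φ r) := by
    simp [ψ, IsFractionRing.map]
  have hb' : algebraMap S (FractionRing S) (φ b) ≠ 0 := by
    rw [Ne, FaithfulSMul.algebraMap_eq_zero_iff]
    exact (map_ne_zero_iff φ hφ).2 hb
  obtain ⟨P, hP, hPx⟩ := hx
  have hint : IsIntegral S (algebraMap S (FractionRing S) (φ a) / algebraMap S _ (φ b)) := by
    refine ⟨P.map φ, hP.map _, ?_⟩
    rw [← hψ, ← hψ, ← map_div₀, Polynomial.eval₂_map]
    have : (algebraMap S (FractionRing S)).comp φ = ψ.comp (algebraMap R (FractionRing R)) :=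
      RingHom.ext fun r => (hψ r).symm
    rw [this, ← Polynomial.hom_eval₂, hPx, map_zero]
  obtain ⟨s, hs⟩ := IsIntegrallyClosed.isIntegral_iff.1 hint
  refine ⟨s, FaithfulSMul.algebraMap_injective S (FractionRing S) ?_⟩
  rw [map_mul, hs, mul_div_cancel₀ _ hb']

end IntegralClosure

/-- Over a domain the degree in each variable is additive, so a divisor brings in no new variable.
-/
theorem MvPolynomial.mem_range_rename_of_dvd {R σ τ : Type*} [CommRing R] [IsDomain R] {k : σ → τ}
    (hk : Function.Injective k) {p : MvPolynomial τ R} {f : MvPolynomial σ R} (hf : f ≠ 0)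
    (h : p ∣ rename k f) : p ∈ (rename k : MvPolynomial σ R →ₐ[R] MvPolynomial τ R).range := by
  obtain ⟨q, hq⟩ := h
  have hne : p * q ≠ 0 := by
    rw [← hq]
    exact (map_ne_zero_iff _ (rename_injective k hk)).2 hf
  refine exists_rename_eq_of_vars_subset_range p k hk fun i hi => ?_
  rw [Finset.mem_coe, mem_vars_iff_degreeOf_ne_zero] at hi
  have h1 : i ∈ (rename k f).vars := by
    rw [mem_vars_iff_degreeOf_ne_zero, hq, degreeOf_mul_eq (left_ne_zero_of_mul hne)
      (right_ne_zero_of_mul hne)]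
    omega
  obtain ⟨j, -, hj⟩ := mem_vars_rename k f h1
  exact ⟨j, hj⟩

/-! ### Coprimality of `K[X]` and `K[Y]` -/

namespace SeparatedPolynomials

open MvPolynomial

variable {K : Type*} [Field K] {n m : ℕ} {p q : MvPolynomial (Fin n ⊕ Fin m) K}

theorem inX_injective : Function.Injective (inX K n m) :=
  rename_injective _ Sum.inl_injective

theorem inY_injective : Function.Injective (inY K n m) :=
  rename_injective _ Sum.inr_injective

theorem inX_C (c : K) : inX K n m (C c) = C c := rename_C _ _

theorem inY_C (c : K) : inY K n m (C c) = C c := rename_C _ _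

theorem eq_zero_of_dvd_inX (hp : p ∉ (inX K n m).range) {f : MvPolynomial (Fin n) K}
    (h : p ∣ inX K n m f) : f = 0 :=
  by_contra fun hf => hp (mem_range_rename_of_dvd Sum.inl_injective hf h)

theorem eq_zero_of_dvd_inY (hp : p ∉ (inY K n m).range) {g : MvPolynomial (Fin m) K}
    (h : p ∣ inY K n m g) : g = 0 :=
  by_contra fun hg => hp (mem_range_rename_of_dvd Sum.inr_injective hg h)

theorem exists_eq_C_of_inX_eq_inY {f : MvPolynomial (Fin n) K} {g : MvPolynomial (Fin m) K}
    (h : inX K n m f = inY K n m g) : ∃ c : K, f = C c ∧ g = C c := by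
  have hf : f = C (constantCoeff g) := by
    have := congrArg (aeval (Sum.elim X 0 : _ → MvPolynomial (Fin n) K)) h
    rw [inX, inY, aeval_rename, aeval_rename, Sum.elim_comp_inl, Sum.elim_comp_inr,
      aeval_X_left_apply] at this
    rw [this]
    exact aeval_zero _
  refine ⟨_, hf, inY_injective (n := n) ?_⟩
  rw [← h, hf, inX_C, inY_C]

/-- A common divisor lies in both `K[X]` and `K[Y]`, hence in `K`. -/
theorem isRelPrime_inX_inY {f : MvPolynomial (Fin n) K} {g : MvPolynomial (Fin m) K}
    (hf : f ≠ 0) (hg : g ≠ 0) : IsRelPrime (inX K n m f) (inY K n m g) := by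
  intro d hdf hdg
  obtain ⟨a, rfl⟩ := mem_range_rename_of_dvd Sum.inl_injective hf hdf
  obtain ⟨b, hb⟩ := mem_range_rename_of_dvd Sum.inr_injective hg hdg
  obtain ⟨c, rfl, -⟩ := exists_eq_C_of_inX_eq_inY (n := n) (m := m) (f := a) (g := b) hb.symm
  have hc : c ≠ 0 := by
    rintro rfl
    refine hf (inX_injective (m := m) ?_)
    have h0 : (0 : MvPolynomial (Fin n ⊕ Fin m) K) ∣ inX K n m f := by simpa using hdf
    rw [zero_dvd_iff.1 h0, map_zero]
  exact (hc.isUnit.map C).map (inX K n m)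

theorem dvd_of_dvd_mul_inX_of_dvd_mul_inY {s : MvPolynomial (Fin n ⊕ Fin m) K}
    {f : MvPolynomial (Fin n) K} {g : MvPolynomial (Fin m) K} (hf : f ≠ 0) (hg : g ≠ 0)
    (h1 : p ∣ s * inX K n m f) (h2 : p ∣ s * inY K n m g) : p ∣ s := by
  rcases eq_or_ne p 0 with rfl | hp
  · rw [zero_dvd_iff] at h1 ⊢
    exact (mul_eq_zero.1 h1).resolve_right ((map_ne_zero_iff _ inX_injective).2 hf)
  -- Here `p = p₁ * p₂` with `p₁ ∣ s` and `p₂ ∣ f`, so `p₂` is coprime to `g`.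
  obtain ⟨p₁, p₂, ⟨s', rfl⟩, hp₂, rfl⟩ := exists_dvd_and_dvd_of_dvd_mul h1
  refine mul_dvd_mul_left p₁ ?_
  rw [mul_assoc] at h2
  have h3 := (mul_dvd_mul_iff_left (left_ne_zero_of_mul hp)).1 h2
  have h4 : IsRelPrime p₂ (inY K n m g) :=
    (isRelPrime_inX_inY hf hg).of_dvd_left hp₂
  exact h4.dvd_of_dvd_mul_right h3

/-! ### Integral closedness of `A(⟨p⟩)` -/

theorem mem_separatedAlgebra_span {a : MvPolynomial (Fin n) K × MvPolynomial (Fin m) K} :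
    a ∈ separatedAlgebra (Ideal.span {p}) ↔ p ∣ inX K n m a.1 - inY K n m a.2 :=
  Ideal.mem_span_singleton

theorem fst_injective (hp : p ∉ (inY K n m).range) :
    Function.Injective ((AlgHom.fst K _ _).comp (separatedAlgebra (Ideal.span {p})).val) := by
  rw [injective_iff_map_eq_zero]
  rintro ⟨⟨f, g⟩, h⟩ (rfl : f = 0)
  rw [mem_separatedAlgebra_span, map_zero, zero_sub, dvd_neg] at h
  obtain rfl := eq_zero_of_dvd_inY hp h
  rfl

theorem snd_injective (hp : p ∉ (inX K n m).range) :
    Function.Injective ((AlgHom.snd K _ _).comp (separatedAlgebra (Ideal.span {p})).val) := by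
  rw [injective_iff_map_eq_zero]
  rintro ⟨⟨f, g⟩, h⟩ (rfl : g = 0)
  rw [mem_separatedAlgebra_span, map_zero, sub_zero] at h
  obtain rfl := eq_zero_of_dvd_inX hp h
  rfl

theorem isIntegrallyClosed_separatedAlgebra (hpX : p ∉ (inX K n m).range)
    (hpY : p ∉ (inY K n m).range) : IsIntegrallyClosed (separatedAlgebra (Ideal.span {p})) := by
  set A := separatedAlgebra (Ideal.span {p})
  have hfst := fst_injective hpY
  have hsnd := snd_injective hpX
  have : IsDomain A := hfst.isDomain ((AlgHom.fst K _ _).comp A.val).toRingHom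
  rw [isIntegrallyClosed_iff (FractionRing A)]
  intro x hx
  obtain ⟨a, b, hb, rfl⟩ := IsFractionRing.div_surjective (A := A) x
  have hb0 : b ≠ 0 := nonZeroDivisors.ne_zero hb
  obtain ⟨s, hs⟩ := dvd_map_of_isIntegral_div ((AlgHom.fst K _ _).comp A.val).toRingHom hfst hb0 hx
  obtain ⟨t, ht⟩ := dvd_map_of_isIntegral_div ((AlgHom.snd K _ _).comp A.val).toRingHom hsnd hb0 hx
  replace hs : a.1.1 = b.1.1 * s := hs
  replace ht : a.1.2 = b.1.2 * t := ht
  have hb1 : b.1.1 ≠ 0 := fun h => hb0 (hfst (by rw [map_zero]; exact h))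
  have hb2 : b.1.2 ≠ 0 := fun h => hb0 (hsnd (by rw [map_zero]; exact h))
  have ha := mem_separatedAlgebra_span.1 a.2
  have hb := mem_separatedAlgebra_span.1 b.2
  rw [hs, ht, map_mul, map_mul] at ha
  have hmem : (s, t) ∈ A := by
    refine mem_separatedAlgebra_span.2 (dvd_of_dvd_mul_inX_of_dvd_mul_inY hb1 hb2 ?_ ?_)
    -- With `b = (b₁, b₂)`: `(s - t) b₁ = (b₁ s - b₂ t) - t (b₁ - b₂)`, and similarly for `b₂`.
    · convert! dvd_sub ha (hb.mul_left (inY K n m t)) using 1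
      ring
    · convert! dvd_sub ha (hb.mul_left (inX K n m s)) using 1
      ring
  refine ⟨⟨(s, t), hmem⟩, ?_⟩
  rw [eq_div_iff ((map_ne_zero_iff _ (IsFractionRing.injective A (FractionRing A))).2 hb0),
    ← map_mul]
  congr 1
  refine Subtype.ext (Prod.ext ?_ ?_)
  · exact (mul_comm _ _).trans hs.symm
  · exact (mul_comm _ _).trans ht.symm

/-! ### Restriction to a line and existence of a generator -/

/-- Restriction of the `Y`-variables to the line through the origin spanned by `y`. -/
noncomputable def toLine (n : ℕ) (y : Fin m → K) :
    MvPolynomial (Fin n ⊕ Fin m) K →ₐ[K] Polynomial (MvPolynomial (Fin n) K) :=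
  aeval (Sum.elim (fun i => Polynomial.C (X i)) fun j => Polynomial.C (C (y j)) * Polynomial.X)

theorem toLine_inX (y : Fin m → K) (f : MvPolynomial (Fin n) K) :
    toLine n y (inX K n m f) = Polynomial.C f := by
  rw [toLine, inX, aeval_rename, Sum.elim_comp_inl]
  have : aeval (fun i => Polynomial.C (X i)) = Polynomial.CAlgHom (R := K)
      (A := MvPolynomial (Fin n) K) := by
    ext; simp
  rw [this]
  rfl

theorem toLine_inY (y : Fin m → K) (g : MvPolynomial (Fin m) K) :
    toLine n y (inY K n m g) =
      Polynomial.mapAlgHom (Algebra.ofId K _)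
        (aeval (fun j => Polynomial.C (y j) * Polynomial.X) g) := by
  rw [toLine, inY, aeval_rename, Sum.elim_comp_inr, ← AlgHom.comp_apply, comp_aeval]
  congr 2
  ext j : 1
  simp [algebraMap_eq]

theorem eval_eval_toLine (x : Fin n → K) (y : Fin m → K) (t : K) :
    eval x ((toLine n y p).eval (C t)) = eval (Sum.elim x (t • y)) p := by
  have : ((aeval x).comp ((Polynomial.aeval (C t : MvPolynomial (Fin n) K)).restrictScalars K)).comp
      (toLine n y) = aeval (Sum.elim x (t • y)) := by
    ext (i | j)
    · simp [toLine]
    · simp [toLine, mul_comm t]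
  exact congrArg (fun φ : _ →ₐ[K] K => φ p) this

/-- If `p` were constant along every line, then `p(x, y) = p(x, 0)` at all points, and over an
infinite field `p` would lie in `K[X]`. -/
theorem exists_natDegree_toLine_ne_zero [Infinite K] (hp : p ∉ (inX K n m).range) :
    ∃ y : Fin m → K, (toLine n y p).natDegree ≠ 0 := by
  by_contra! hc
  refine hp ⟨(toLine n (0 : Fin m → K) p).eval 0, MvPolynomial.funext fun z => ?_⟩
  obtain ⟨f, hf⟩ := Polynomial.natDegree_eq_zero.1 (hc (z ∘ Sum.inr))
  have h0 := eval_eval_toLine (p := p) (z ∘ Sum.inl) (z ∘ Sum.inr) 0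
  have h1 := eval_eval_toLine (p := p) (z ∘ Sum.inl) (z ∘ Sum.inr) 1
  have h2 := eval_eval_toLine (p := p) (z ∘ Sum.inl) (0 : Fin m → K) 0
  rw [← hf, Polynomial.eval_C] at h0 h1
  rw [smul_zero] at h2
  rw [zero_smul] at h0
  rw [one_smul, Sum.elim_comp_inl_inr] at h1
  rw [← h1, h0, ← h2, AlgHom.toRingHom_eq_coe, RingHom.coe_coe, inX, eval_rename, map_zero]

theorem exists_isGenerator [Infinite K] (hp : ∃ q, IsSeparatedMultiple p q)
    (hpX : p ∉ (inX K n m).range) (hpY : p ∉ (inY K n m).range) : ∃ f g, IsGenerator p f g := by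
  set A := separatedAlgebra (Ideal.span {p})
  obtain ⟨y, hy⟩ := exists_natDegree_toLine_ne_zero hpX
  -- This makes `φ` injective: if `g` vanishes on the line, the restricted `p` divides `f`.
  have hdvd : ∀ f : MvPolynomial (Fin n) K, toLine n y p ∣ Polynomial.C f → f = 0 := by
    intro f hf
    by_contra hne
    have := Polynomial.natDegree_le_of_dvd hf (Polynomial.C_ne_zero.2 hne)
    rw [Polynomial.natDegree_C] at this
    exact hy (Nat.le_zero.1 this)
  let φ : A →ₐ[K] Polynomial K := (aeval fun j => Polynomial.C (y j) * Polynomial.X).comp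
    ((AlgHom.snd K _ _).comp A.val)
  have hφ : Function.Injective φ := by
    rw [injective_iff_map_eq_zero]
    rintro ⟨⟨f, g⟩, h⟩ h0
    replace h0 : aeval (fun j => Polynomial.C (y j) * Polynomial.X) g = 0 := h0
    have h1 := map_dvd (toLine n y) (mem_separatedAlgebra_span.1 h)
    rw [map_sub, toLine_inX, toLine_inY, h0, map_zero, sub_zero] at h1
    exact fst_injective hpY (hdvd f h1)
  let e : A ≃ₐ[K] φ.range := AlgEquiv.ofInjective φ hφ
  have := isIntegrallyClosed_separatedAlgebra hpX hpY
  have hcl : IsIntegrallyClosed φ.range := IsIntegrallyClosed.of_equiv e.toRingEquiv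
  obtain ⟨_, hne, ⟨f, g, rfl⟩, hfg⟩ := hp
  have hmem : (f, g) ∈ A := mem_separatedAlgebra_span.2 hfg
  have hdeg : (φ ⟨(f, g), hmem⟩).natDegree ≠ 0 := by
    intro h0
    obtain ⟨c, hc⟩ := Polynomial.natDegree_eq_zero.1 h0
    have h1 : (⟨(f, g), hmem⟩ : A) = algebraMap K A c :=
      hφ (hc.symm.trans (φ.commutes c).symm)
    have h2 : (f, g) = (C c, C c) := congrArg Subtype.val h1
    rw [Prod.mk.injEq] at h2
    rw [h2.1, h2.2, inX_C, inY_C, sub_self] at hne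
    exact hne rfl
  obtain ⟨h, hh⟩ := φ.range.exists_eq_adjoin_singleton ⟨_, rfl⟩ hdeg
  obtain ⟨a, ha⟩ : h ∈ φ.range := by
    rw [hh]
    exact Algebra.self_mem_adjoin_singleton K h
  refine ⟨a.1.1, a.1.2, ?_⟩
  have h3 : Algebra.adjoin K {a} = ⊤ := by
    refine Subalgebra.map_injective hφ ?_
    rw [AlgHom.map_adjoin, Set.image_singleton, Algebra.map_top, hh]
    exact congrArg (fun z => Algebra.adjoin K {z}) ha
  have h4 := congrArg (Subalgebra.map A.val) h3
  rw [AlgHom.map_adjoin, Set.image_singleton, Algebra.map_top, Subalgebra.range_val] at h4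
  exact h4

/-! ### Generators and minimal separated multiples -/

theorem IsGenerator.dvd {f : MvPolynomial (Fin n) K} {g : MvPolynomial (Fin m) K}
    (h : IsGenerator p f g) : p ∣ inX K n m f - inY K n m g := by
  have hmem : (f, g) ∈ Algebra.adjoin K {(f, g)} := Algebra.self_mem_adjoin_singleton K (f, g)
  rw [show Algebra.adjoin K {(f, g)} = _ from h, mem_separatedAlgebra_span] at hmem
  exact hmem

theorem isMinimalSeparatedMultiple_of_isGenerator (hp : ∃ q, IsSeparatedMultiple p q)
    {f : MvPolynomial (Fin n) K} {g : MvPolynomial (Fin m) K} (h : IsGenerator p f g) :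
    IsMinimalSeparatedMultiple p (inX K n m f - inY K n m g) := by
  have hdvd : ∀ r, IsSeparatedMultiple p r → inX K n m f - inY K n m g ∣ r := by
    rintro _ ⟨-, ⟨F, G, rfl⟩, hFG⟩
    have hmem : (F, G) ∈ Algebra.adjoin K {(f, g)} := by
      rw [h]
      exact mem_separatedAlgebra_span.2 hFG
    obtain ⟨P, hP⟩ := Algebra.adjoin_mem_exists_aeval K _ hmem
    have h1 : Polynomial.aeval f P = F := by
      refine Eq.trans ?_ (congrArg Prod.fst hP)
      exact Polynomial.aeval_algHom_apply (AlgHom.fst K _ _) (f, g) P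
    have h2 : Polynomial.aeval g P = G := by
      refine Eq.trans ?_ (congrArg Prod.snd hP)
      exact Polynomial.aeval_algHom_apply (AlgHom.snd K _ _) (f, g) P
    rw [← h1, ← h2, ← Polynomial.aeval_algHom_apply, ← Polynomial.aeval_algHom_apply,
      ← Polynomial.eval_map_algebraMap, ← Polynomial.eval_map_algebraMap]
    exact Polynomial.sub_dvd_eval_sub _ _ _
  obtain ⟨r, hr⟩ := hp
  refine ⟨⟨?_, ⟨f, g, rfl⟩, ?_⟩, hdvd⟩
  · intro h0
    have := hdvd r hr
    rw [h0, zero_dvd_iff] at this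
    exact hr.1 this
  · exact h.dvd

theorem isMinimalSeparatedMultiple_self_of_isSeparated (hp : p ≠ 0) (hs : IsSeparated p) :
    IsMinimalSeparatedMultiple p p :=
  ⟨⟨hp, hs, dvd_rfl⟩, fun _ hr => hr.2.2⟩

theorem exists_isMinimalSeparatedMultiple [Infinite K] (hp : ∃ q, IsSeparatedMultiple p q) :
    ∃ q, IsMinimalSeparatedMultiple p q := by
  have hp0 : p ≠ 0 := by
    rintro rfl
    obtain ⟨q, hq⟩ := hp
    exact hq.1 (zero_dvd_iff.1 hq.2.2)
  by_cases hpX : p ∈ (inX K n m).range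
  · obtain ⟨f, hf⟩ := hpX
    exact ⟨p, isMinimalSeparatedMultiple_self_of_isSeparated hp0
      ⟨f, 0, by rw [map_zero, sub_zero]; exact hf.symm⟩⟩
  by_cases hpY : p ∈ (inY K n m).range
  · obtain ⟨g, hg⟩ := hpY
    exact ⟨p, isMinimalSeparatedMultiple_self_of_isSeparated hp0
      ⟨0, -g, by rw [map_zero, map_neg, zero_sub, neg_neg]; exact hg.symm⟩⟩
  obtain ⟨f, g, h⟩ := exists_isGenerator hp hpX hpY
  exact ⟨_, isMinimalSeparatedMultiple_of_isGenerator hp h⟩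

theorem IsMinimalSeparatedMultiple.exists_eq_C_mul {q' : MvPolynomial (Fin n ⊕ Fin m) K}
    (hq : IsMinimalSeparatedMultiple p q) (hq' : IsMinimalSeparatedMultiple p q') :
    ∃ c : K, c ≠ 0 ∧ q' = C c * q := by
  obtain ⟨u, hu⟩ := associated_of_dvd_dvd (hq.2 _ hq'.1) (hq'.2 _ hq.1)
  obtain ⟨c, hc, hcu⟩ := isUnit_iff_eq_C_of_isReduced.1 u.isUnit
  exact ⟨c, hc.ne_zero, by rw [← hu, hcu, mul_comm]⟩

theorem IsMinimalSeparatedMultiple.C_mul (hq : IsMinimalSeparatedMultiple p q) {c : K}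
    (hc : c ≠ 0) : IsMinimalSeparatedMultiple p (C c * q) := by
  obtain ⟨⟨hq0, ⟨f, g, rfl⟩, hpq⟩, hmin⟩ := hq
  have hu : IsUnit (C c : MvPolynomial (Fin n ⊕ Fin m) K) := hc.isUnit.map C
  refine ⟨⟨mul_ne_zero hu.ne_zero hq0, ⟨C c * f, C c * g, ?_⟩, hpq.mul_left _⟩,
    fun r hr => hu.mul_left_dvd.2 (hmin r hr)⟩
  rw [map_mul, map_mul, inX_C, inY_C, mul_sub]

/-- By uniqueness `f' - g' = c (f - g)`. Then `f' - c f = g' - c g` lies in `K[X] ∩ K[Y] = K`, so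
the two pairs differ by an invertible affine change over `K`. -/
theorem isGenerator_of_isMinimalSeparatedMultiple {f f' : MvPolynomial (Fin n) K}
    {g g' : MvPolynomial (Fin m) K} (hp : ∃ q, IsSeparatedMultiple p q) (h : IsGenerator p f g)
    (h' : IsMinimalSeparatedMultiple p (inX K n m f' - inY K n m g')) : IsGenerator p f' g' := by
  obtain ⟨c, hc, heq⟩ := (isMinimalSeparatedMultiple_of_isGenerator hp h).exists_eq_C_mul h'
  obtain ⟨d, hf, hg⟩ := exists_eq_C_of_inX_eq_inY (f := f' - C c * f) (g := g' - C c * g) (by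
    rw [map_sub, map_sub, map_mul, map_mul, inX_C, inY_C]
    linear_combination heq)
  have hmem' : (f', g') ∈ separatedAlgebra (Ideal.span {p}) := mem_separatedAlgebra_span.2 h'.1.2.2
  refine le_antisymm (Algebra.adjoin_le (by simpa using hmem')) ?_
  rw [← h]
  refine Algebra.adjoin_le (Set.singleton_subset_iff.2 ?_)
  have key : (f, g) = algebraMap K _ c⁻¹ * ((f', g') - algebraMap K _ d) := by
    have h1 : (C c⁻¹ * C c : MvPolynomial (Fin n) K) = 1 := by
      rw [← C_mul, inv_mul_cancel₀ hc, C_1]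
    have h2 : (C c⁻¹ * C c : MvPolynomial (Fin m) K) = 1 := by
      rw [← C_mul, inv_mul_cancel₀ hc, C_1]
    refine Prod.ext ?_ ?_
    · change f = C c⁻¹ * (f' - C d)
      linear_combination (-C c⁻¹) * hf - f * h1
    · change g = C c⁻¹ * (g' - C d)
      linear_combination (-C c⁻¹) * hg - g * h2
  rw [SetLike.mem_coe, key]
  exact mul_mem (Subalgebra.algebraMap_mem _ _)
    (sub_mem (Algebra.self_mem_adjoin_singleton K _) (Subalgebra.algebraMap_mem _ _))

end SeparatedPolynomials

theorem mainTheorem3 {K : Type*} [Field K] [CharZero K] (n m : ℕ)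
    (p : MvPolynomial (Fin n ⊕ Fin m) K)
    (hp : ∃ q, SeparatedPolynomials.IsSeparatedMultiple p q) :
    (∃ q, SeparatedPolynomials.IsMinimalSeparatedMultiple p q) ∧
    (∀ q, SeparatedPolynomials.IsMinimalSeparatedMultiple p q →
      ∀ q', SeparatedPolynomials.IsMinimalSeparatedMultiple p q' ↔
        ∃ c : K, c ≠ 0 ∧ q' = MvPolynomial.C c * q) ∧
    (p ∉ (SeparatedPolynomials.inX K n m).range →
      p ∉ (SeparatedPolynomials.inY K n m).range →
      (∃ f g, SeparatedPolynomials.IsGenerator p f g) ∧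
      ∀ f g, SeparatedPolynomials.IsGenerator p f g ↔
        SeparatedPolynomials.IsMinimalSeparatedMultiple p
          (SeparatedPolynomials.inX K n m f - SeparatedPolynomials.inY K n m g)) := by
  have : Infinite K := CharZero.infinite K
  refine ⟨SeparatedPolynomials.exists_isMinimalSeparatedMultiple hp, fun q hq q' => ⟨fun hq' =>
    hq.exists_eq_C_mul hq', ?_⟩, fun hpX hpY => ?_⟩
  · rintro ⟨c, hc, rfl⟩
    exact hq.C_mul hc
  · obtain ⟨f₀, g₀, h₀⟩ := SeparatedPolynomials.exists_isGenerator hp hpX hpY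
    exact ⟨⟨f₀, g₀, h₀⟩, fun f g =>
      ⟨SeparatedPolynomials.isMinimalSeparatedMultiple_of_isGenerator hp,
        SeparatedPolynomials.isGenerator_of_isMinimalSeparatedMultiple hp h₀⟩⟩
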